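/- Let $M$ be a countable model of ZFC (a set with a binary relation interpreting $\in$, not necessarily well-founded). Let $\mathcal{N}$ be a structure in $M$ in a finite language, that is, the domain of $\mathcal{N}$ and the interpretations of the finitely many function, relation and constant symbols are objects of $M$ that $M$ regards as a set and as functions and relations of the correct arities on that set. Let $S\in M$ be an additional predicate on $\mathcal{N}$, that is, an object $S$ of $M$ with $M\models S\subseteq\mathcal{N}^k$ for some $k$ (for $k=1$, a subset of the domain of $\mathcal{N}$). For a model $M'$ of set theory having these objects as elements, write $\mathcal{N}^{M'}$ and $S^{M'}$ for the structure and the predicate that $M'$ sees: the domain of $\mathcal{N}^{M'}$ is the set of objects that $M'$ regards as elements of $\mathcal{N}$, and its functions and relations, as well as $S^{M'}$, consist of the tuples of such objects that $M'$ regards as belonging to the corresponding object. Suppose that $S^M$ is not definable in the structure $\mathcal{N}^M$ by a first-order formula with parameters from $\mathcal{N}^M$. Then there are elementary extensions $M\prec M_1$ and $M\prec M_2$ which agree on the structure, $\mathcal{N}^{M_1}=\mathcal{N}^{M_2}$ (literally the same elements, the same language, and the same interpretations of the functions, relations and constants of this language), yet disagree on the extension of the additional predicate, $S^{M_1}\neq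 S^{M_2}$. -/

import Mathlib

open FirstOrder

universe u v w

/-! ### The first-order language of set theory -/

/-- The only symbol of the language of set theory: a binary relation symbol. -/
inductive MemRel : ℕ → Type
  | mem : MemRel 2

/-- The first-order language of set theory. -/
def setLanguage : FirstOrder.Language.{0, 0} := ⟨fun _ => Empty, MemRel⟩

/-- A type `M` with a binary relation `E`, as a structure in the language of set theory. -/
@[reducible] def memStructure {M : Type u} (E : M → M → Prop) : setLanguage.Structure M where
  funMap := fun f _ => Empty.elim f
  RelMap := fun r => match r with
    | MemRel.mem => fun x => E (x 0) (x 1)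

/-- `(M, E)` is a model of ZFC. The relation `E` need not be well-founded.  The two schemes range
over all classes, resp. class relations, that are first-order definable over `(M, E)` with
parameters from `M`. -/
structure IsModelOfZFC {M : Type u} (E : M → M → Prop) : Prop where
  extensionality : ∀ a b, (∀ x, E x a ↔ E x b) → a = b
  foundation : ∀ a, (∃ x, E x a) → ∃ x, E x a ∧ ∀ y, E y x → ¬ E y a
  pairing : ∀ a b, ∃ c, ∀ x, E x c ↔ x = a ∨ x = b
  union : ∀ a, ∃ c, ∀ x, E x c ↔ ∃ y, E y a ∧ E x y
  powerset : ∀ a, ∃ c, ∀ x, E x c ↔ ∀ y, E y x → E y a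
  infinity : ∃ a, (∃ z, E z a ∧ ∀ y, ¬ E y z) ∧
    ∀ x, E x a → ∃ s, E s a ∧ ∀ y, E y s ↔ E y x ∨ y = x
  separation : letI := memStructure E
    ∀ D : Set M, Set.univ.Definable₁ setLanguage D →
      ∀ a, ∃ b, ∀ x, E x b ↔ E x a ∧ x ∈ D
  replacement : letI := memStructure E
    ∀ R : Set (M × M), Set.univ.Definable₂ setLanguage R →
      ∀ a, (∀ x, E x a → ∃! y, (x, y) ∈ R) → ∃ b, ∀ y, E y b ↔ ∃ x, E x a ∧ (x, y) ∈ R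
  choice : ∀ a, (∀ x, E x a → ∃ y, E y x) →
    (∀ x y z, E x a → E y a → E z x → E z y → x = y) →
      ∃ c, ∀ x, E x a → ∃! y, E y x ∧ E y c

/-- `i : M → K` makes `(K, E')` an elementary extension of `(M, E)`. -/
def IsElementaryExtension {M : Type u} {K : Type v} (E : M → M → Prop) (E' : K → K → Prop)
    (i : M → K) : Prop :=
  letI := memStructure E
  letI := memStructure E'
  ∃ j : M ↪ₑ[setLanguage] K, (j : M → K) = i

/-! ### Tuples, relations and functions inside a model -/

/-- `(M, E)` thinks that `p` is the Kuratowski pair `{{a}, {a, b}}`. -/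
def IsPair {M : Type u} (E : M → M → Prop) (a b p : M) : Prop :=
  ∀ z, E z p ↔ (∀ y, E y z ↔ y = a) ∨ (∀ y, E y z ↔ y = a ∨ y = b)

/-- `(M, E)` thinks that `t` is the tuple `(x 0, …, x (n - 1))`: the empty set for `n = 0`, the
element itself for `n = 1`, and the pair `((x 0, …, x (n - 2)), x (n - 1))` for `n ≥ 2`. -/
def IsTuple {M : Type u} (E : M → M → Prop) : (n : ℕ) → (Fin n → M) → M → Prop
  | 0, _, t => ∀ y, ¬ E y t
  | 1, x, t => t = x 0
  | n + 2, x, t => ∃ p, IsTuple E (n + 1) (Fin.init x) p ∧ IsPair E p (x (Fin.last (n + 1))) t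

/-- The extension of `r` in `(M, E)`, read as an `n`-ary relation: the set of all `n`-tuples that
`(M, E)` thinks are in `r`. -/
def extension {M : Type u} (E : M → M → Prop) (n : ℕ) (r : M) : Set (Fin n → M) :=
  {x | ∃ t, IsTuple E n x t ∧ E t r}

/-- `(M, E)` thinks that `r` is a subset of the `n`-th power of `d`. -/
def IsRelationOn {M : Type u} (E : M → M → Prop) (d : M) (n : ℕ) (r : M) : Prop :=
  ∀ t, E t r → ∃ x : Fin n → M, (∀ j, E (x j) d) ∧ IsTuple E n x t

/-- `(M, E)` thinks that `f` is (the graph of) a function from the `n`-th power of `d` to `d`. -/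
def IsFunctionOn {M : Type u} (E : M → M → Prop) (d : M) (n : ℕ) (f : M) : Prop :=
  IsRelationOn E d (n + 1) f ∧
    ∀ x : Fin n → M, (∀ j, E (x j) d) →
      ∃! y, E y d ∧ (Fin.snoc x y : Fin (n + 1) → M) ∈ extension E (n + 1) f

/-! ### First-order structures inside a model -/

/-- The data of an `L`-structure given by objects of a model of set theory with underlying type `M`:
a domain, and an object interpreting each symbol of `L` (constants are the nullary functions). -/
structure ObjectStructure (L : FirstOrder.Language.{v, w}) (M : Type u) where
  dom : M
  fn : ∀ {n : ℕ}, L.Functions n → M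
  rel : ∀ {n : ℕ}, L.Relations n → M

namespace ObjectStructure

variable {L : FirstOrder.Language.{v, w}} {M : Type u}

/-- `(M, E)` thinks that `N` is an `L`-structure. -/
structure IsStructureIn (N : ObjectStructure L M) (E : M → M → Prop) : Prop where
  isFunctionOn : ∀ {n : ℕ} (f : L.Functions n), IsFunctionOn E N.dom n (N.fn f)
  isRelationOn : ∀ {n : ℕ} (r : L.Relations n), IsRelationOn E N.dom n (N.rel r)

/-- The elements of `N`, in the sense of `(M, E)`. -/
def carrier (N : ObjectStructure L M) (E : M → M → Prop) : Set M := {x | E x N.dom}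

/-- The `L`-structure that `N` is, in the sense of `(M, E)`. -/
@[reducible] noncomputable def toStructure (N : ObjectStructure L M) (E : M → M → Prop)
    (h : N.IsStructureIn E) : L.Structure (N.carrier E) where
  funMap := fun {_} f x =>
    ⟨Classical.choose ((h.isFunctionOn f).2 (fun j => (x j : M)) (fun j => (x j).2)),
      (Classical.choose_spec
        ((h.isFunctionOn f).2 (fun j => (x j : M)) (fun j => (x j).2))).1.1⟩
  RelMap := fun {n} r x => (fun j => (x j : M)) ∈ extension E n (N.rel r)

/-- The `k`-ary predicate `S`, as a relation on the elements of `N`, is definable with parameters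
in the structure that `N` is in the sense of `(M, E)`. -/
def IsDefinablePredicate (N : ObjectStructure L M) (E : M → M → Prop) (h : N.IsStructureIn E) (k : ℕ) (S : M) :
    Prop :=
  letI := N.toStructure E h
  Set.univ.Definable L {x : Fin k → N.carrier E | (fun j => (x j : M)) ∈ extension E k S}

/-- The objects that make up `N`, viewed as objects of an extension. -/
def map {K : Type*} (i : M → K) (N : ObjectStructure L M) : ObjectStructure L K where
  dom := i N.dom
  fn := fun f => i (N.fn f)
  rel := fun r => i (N.rel r)

/-- `N` is literally the same structure in the sense of `(M, E₁)` and of `(M, E₂)`: it has the same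
elements, and each symbol of the language has the same interpretation. -/
structure SameStructure (N : ObjectStructure L M) (E₁ E₂ : M → M → Prop) : Prop where
  carrier_eq : N.carrier E₁ = N.carrier E₂
  fn_eq : ∀ {n : ℕ} (f : L.Functions n),
    extension E₁ (n + 1) (N.fn f) = extension E₂ (n + 1) (N.fn f)
  rel_eq : ∀ {n : ℕ} (r : L.Relations n), extension E₁ n (N.rel r) = extension E₂ n (N.rel r)

end ObjectStructure

/-!
The two models live on the same set `K` and differ by a permutation `π` of `K`: the second
membership relation is the pullback of the first along `π`. It is then enough that `π` fixes the
ground model pointwise, restricts to an automorphism of the structure `N` as `K` sees it, and does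
not preserve `S`. Such a permutation comes from Ehrenfeucht–Fraïssé games.

For finitely many definable relations on `N` and a finite number `r` of rounds, the equivalence of
tuples in the game of length `r` has finitely many classes, all definable in `N` with parameters
(`exists_finite_definable_rankEquiv`). If `S` is not definable, it is therefore not a union of such
classes, so there are a tuple in `S` and one outside of `S` that are equivalent
(`exists_rankEquiv_of_not_definable`). The relations to be preserved are the relations and the
graphs of functions of `N`, equality, and the singletons of elements of `N`; there are countably
many of them. Taking at stage `m` the first `m` of these relations and about `m` rounds, the
sequences of the tuples found represent tuples `a` and `b` of the ultrapower of the model by a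
nonprincipal ultrafilter on `ℕ`. By Łoś's theorem `a` is in `S` and `b` is not. The second player
can go on forever from the position `(a, b)` in the ultrapower, since along the ultrafilter the
number of rounds left is unbounded (`UltraEquiv.forth`, `UltraEquiv.back`).

To play all elements in `ω` moves, one passes to a countable elementary submodel `K` of the
ultrapower that contains the ground model, `a` and `b` and is closed under the answers of the second
player (`exists_countable_elementary_closed`). The back-and-forth construction in `K` gives a
permutation of the elements of `N` that preserves the relations, hence fixes the elements from the
ground model, and maps `a` to `b`; extended by the identity, it is the required `π`
(`exists_elementaryExtension_perm`).
-/

/-! ### Finite-rank back-and-forth equivalence -/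

section RankEquiv

variable {A : Type*}

/-- The pairs in `l` preserve all relations in `Q`: replacing first by second components does not
change whether a tuple is in a relation. -/
def AtomEquiv (Q : Set (Σ n, Set (Fin n → A))) (l : List (A × A)) : Prop :=
  ∀ q ∈ Q, ∀ z : Fin q.1 → A × A, (∀ j, z j ∈ l) →
    ((fun j => (z j).1) ∈ q.2 ↔ (fun j => (z j).2) ∈ q.2)

/-- The second player survives `r` more rounds of the Ehrenfeucht–Fraïssé game for the relations in
`Q`, played from the position in which the pairs in `l` have been chosen. -/
def RankEquiv (Q : Set (Σ n, Set (Fin n → A))) : ℕ → List (A × A) → Prop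
  | 0, l => AtomEquiv Q l
  | r + 1, l => AtomEquiv Q l ∧ (∀ c, ∃ d, RankEquiv Q r ((c, d) :: l)) ∧
      ∀ d, ∃ c, RankEquiv Q r ((c, d) :: l)

theorem RankEquiv.atomEquiv {Q : Set (Σ n, Set (Fin n → A))} {r : ℕ} {l : List (A × A)}
    (h : RankEquiv Q r l) : AtomEquiv Q l := by
  cases r with
  | zero => exact h
  | succ r => exact h.1

variable {L : FirstOrder.Language.{v, w}} [L.Structure A] {P : Set A}

/-- The tuples that belong, among the sets in `F`, to exactly those in `s`. -/
def agreementClass {n : ℕ} (F s : Set (Set (Fin n → A))) : Set (Fin n → A) :=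
  {x | ∀ D ∈ F, x ∈ D ↔ D ∈ s}

theorem definable_agreementClass {n : ℕ} {F : Set (Set (Fin n → A))} (hF : F.Finite)
    (hd : ∀ D ∈ F, P.Definable L D) (s : Set (Set (Fin n → A))) :
    P.Definable L (agreementClass F s) := by
  classical
  have := hF.to_subtype
  have h : agreementClass F s = ⋂ D : F, (if D.1 ∈ s then D.1 else D.1ᶜ) := by
    ext x
    simp only [agreementClass, Set.mem_ofPred_eq, Set.mem_iInter, Subtype.forall]
    refine forall₂_congr fun D _ => ?_
    split_ifs with hs <;> simp [hs]
  rw [h]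
  refine Set.definable_iInter_of_finite fun D => ?_
  split_ifs
  · exact hd _ D.2
  · exact (hd _ D.2).compl

/-- Tuples are atomically equivalent as soon as they agree on finitely many definable sets, namely
all ways to substitute coordinates into the given relations. -/
theorem exists_finite_definable_atomEquiv {Q : Set (Σ n, Set (Fin n → A))} (hQ : Q.Finite)
    (hd : ∀ q ∈ Q, P.Definable L q.2) (n : ℕ) :
    ∃ F : Set (Set (Fin n → A)), F.Finite ∧ (∀ D ∈ F, P.Definable L D) ∧
      ∀ x y, (∀ D ∈ F, x ∈ D ↔ y ∈ D) → AtomEquiv Q (List.ofFn fun i => (x i, y i)) := by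
  have := hQ.to_subtype
  refine ⟨Set.range fun p : Σ q : Q, (Fin q.1.1 → Fin n) =>
    (fun g : Fin n → A => g ∘ p.2) ⁻¹' p.1.1.2, Set.finite_range _, ?_, ?_⟩
  · rintro _ ⟨p, rfl⟩
    exact (hd _ p.1.2).preimage_comp _
  · intro x y h q hq z hz
    choose e he using fun j => (List.mem_ofFn' _ _).1 (hz j)
    have := h _ ⟨⟨⟨q, hq⟩, e⟩, rfl⟩
    simp only [← he]
    exact this

/-- Each rank has finitely many equivalence classes, all of them definable: tuples are equivalent
as soon as they agree on a suitable finite family of definable sets. -/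
theorem exists_finite_definable_rankEquiv {Q : Set (Σ n, Set (Fin n → A))} (hQ : Q.Finite)
    (hd : ∀ q ∈ Q, P.Definable L q.2) (r n : ℕ) :
    ∃ F : Set (Set (Fin n → A)), F.Finite ∧ (∀ D ∈ F, P.Definable L D) ∧
      ∀ x y, (∀ D ∈ F, x ∈ D ↔ y ∈ D) → RankEquiv Q r (List.ofFn fun i => (x i, y i)) := by
  induction r generalizing n with
  | zero => exact exists_finite_definable_atomEquiv hQ hd n
  | succ r ih =>
    obtain ⟨F₀, hF₀, hd₀, h₀⟩ := exists_finite_definable_atomEquiv hQ hd n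
    obtain ⟨F, hF, hdF, h⟩ := ih (n + 1)
    -- The sets of tuples that some extra coordinate carries into a given class of the lower rank.
    let G : Set (Set (Fin n → A)) :=
      (fun s => (fun g : Fin (n + 1) → A => g ∘ Fin.succ) '' agreementClass F s) '' 𝒫 F
    have hG : ∀ x y, (∀ D ∈ G, x ∈ D ↔ y ∈ D) → ∀ c, ∃ d, ∀ D ∈ F,
        (Fin.cons c x : Fin (n + 1) → A) ∈ D ↔ (Fin.cons d y : Fin (n + 1) → A) ∈ D := by
      intro x y hxy c
      have hmem := (hxy _ ⟨{D ∈ F | (Fin.cons c x : Fin (n + 1) → A) ∈ D},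
        fun D hD => hD.1, rfl⟩).1 ⟨Fin.cons c x, fun D hD => by simp [hD], by ext; simp⟩
      obtain ⟨g, hg, rfl⟩ := hmem
      refine ⟨g 0, fun D hD => ?_⟩
      have : (Fin.cons (g 0) (g ∘ Fin.succ) : Fin (n + 1) → A) = g := Fin.cons_self_tail g
      rw [this, hg D hD]
      simp [hD]
    refine ⟨F₀ ∪ G, hF₀.union (hF.powerset.image _), ?_, fun x y hxy =>
      ⟨h₀ x y fun D hD => hxy D (.inl hD), fun c => ?_, fun d => ?_⟩⟩
    · rintro D (hD | ⟨s, -, rfl⟩)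
      · exact hd₀ D hD
      · exact (definable_agreementClass hF hdF s).image_comp Fin.succ
    · obtain ⟨d, hcd⟩ := hG x y (fun D hD => hxy D (.inr hD)) c
      exact ⟨d, by simpa [List.ofFn_succ] using h _ _ hcd⟩
    · obtain ⟨c, hcd⟩ := hG y x (fun D hD => (hxy D (.inr hD)).symm) d
      exact ⟨c, by simpa [List.ofFn_succ] using h _ _ fun D hD => (hcd D hD).symm⟩

/-- A set that is not definable splits some class of each finite rank. -/
theorem exists_rankEquiv_of_not_definable {Q : Set (Σ n, Set (Fin n → A))} (hQ : Q.Finite)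
    (hd : ∀ q ∈ Q, P.Definable L q.2) (r : ℕ) {k : ℕ} {S : Set (Fin k → A)}
    (hS : ¬ P.Definable L S) :
    ∃ x ∈ S, ∃ y ∉ S, RankEquiv Q r (List.ofFn fun i => (x i, y i)) := by
  obtain ⟨F, hF, hdF, h⟩ := exists_finite_definable_rankEquiv hQ hd r k
  by_contra! hcon
  refine hS ?_
  let T : Set (Set (Set (Fin k → A))) := (fun x => {D ∈ F | x ∈ D}) '' S
  have hT : T.Finite := hF.powerset.subset (by rintro _ ⟨x, -, rfl⟩ D hD; exact hD.1)
  have := hT.to_subtype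
  have hSu : S = ⋃ s : T, agreementClass F s.1 := by
    ext y
    simp only [Set.mem_iUnion]
    constructor
    · exact fun hy => ⟨⟨_, y, hy, rfl⟩, fun D hD => by simp [hD]⟩
    · rintro ⟨⟨_, x, hx, rfl⟩, hy⟩
      by_contra hyS
      exact hcon x hx y hyS (h x y fun D hD => by simp [hy D hD, hD])
  rw [hSu]
  exact Set.definable_iUnion_of_finite fun s => definable_agreementClass hF hdF _

end RankEquiv

/-! ### Back-and-forth and closure arguments over countable sets -/

/-- A back-and-forth property of finite lists of pairs yields a total and surjective correspondence
all of whose finite parts lie in lists with that property. -/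
theorem exists_correspondence_of_backAndForth {A : Type*} [Countable A]
    (G : List (A × A) → Prop) (forth : ∀ l, G l → ∀ c, ∃ d, G ((c, d) :: l))
    (back : ∀ l, G l → ∀ d, ∃ c, G ((c, d) :: l)) (l₀ : List (A × A)) (h₀ : G l₀) :
    ∃ C : Set (A × A), (∀ p ∈ l₀, p ∈ C) ∧ (∀ c, ∃ d, (c, d) ∈ C) ∧ (∀ d, ∃ c, (c, d) ∈ C) ∧
      ∀ l : List (A × A), (∀ p ∈ l, p ∈ C) → ∃ l', G l' ∧ l ⊆ l' := by
  rcases isEmpty_or_nonempty A with hA | hA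
  · exact ⟨∅, fun p => hA.elim p.1, hA.elim, hA.elim, fun l _ => ⟨l₀, h₀, fun p => hA.elim p.1⟩⟩
  obtain ⟨e, he⟩ := exists_surjective_nat A
  have step : ∀ (n : ℕ) (l : {l // G l}), ∃ l' : {l // G l}, l.1 ⊆ l'.1 ∧
      (∃ d, (e n, d) ∈ l'.1) ∧ ∃ c, (c, e n) ∈ l'.1 := by
    rintro n ⟨l, hl⟩
    obtain ⟨d, hd⟩ := forth l hl (e n)
    obtain ⟨c, hc⟩ := back _ hd (e n)
    exact ⟨⟨_, hc⟩, fun p hp => by simp [hp], ⟨d, by simp⟩, ⟨c, by simp⟩⟩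
  choose f hsub hf hb using step
  let s : ℕ → {l // G l} := fun n => Nat.rec ⟨l₀, h₀⟩ f n
  have hmono : ∀ m n, m ≤ n → (s m).1 ⊆ (s n).1 := fun m n hmn => by
    induction hmn with
    | refl => exact fun _ h => h
    | step _ ih => exact fun _ h => hsub _ _ (ih h)
  refine ⟨{p | ∃ n, p ∈ (s n).1}, fun p hp => ⟨0, hp⟩, fun c => ?_, fun d => ?_, fun l hl => ?_⟩
  · obtain ⟨n, rfl⟩ := he c
    obtain ⟨d, hd⟩ := hf n (s n)
    exact ⟨d, n + 1, hd⟩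
  · obtain ⟨n, rfl⟩ := he d
    obtain ⟨c, hc⟩ := hb n (s n)
    exact ⟨c, n + 1, hc⟩
  · suffices h : ∃ n, l ⊆ (s n).1 by
      obtain ⟨n, hn⟩ := h
      exact ⟨_, (s n).2, hn⟩
    induction l with
    | nil => exact ⟨0, by simp⟩
    | cons p l ih =>
      obtain ⟨n, hn⟩ := ih fun q hq => hl q (by simp [hq])
      obtain ⟨m, hm⟩ := hl p (by simp)
      refine ⟨max m n, List.cons_subset.2 ⟨hmono _ _ (le_max_left _ _) hm,
        fun q hq => hmono _ _ (le_max_right _ _) (hn hq)⟩⟩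

/-- A countable set has a countable superset closed under a countably-valued finitary operation. -/
theorem exists_countable_closed {U : Type*} (g : Finset U → Set U) (hg : ∀ s, (g s).Countable)
    {B : Set U} (hB : B.Countable) :
    ∃ K : Set U, K.Countable ∧ B ⊆ K ∧ ∀ s : Finset U, (s : Set U) ⊆ K → g s ⊆ K := by
  let f : Set U → Set U := fun K => K ∪ ⋃ s ∈ {s : Finset U | (s : Set U) ⊆ K}, g s
  let K : ℕ → Set U := fun n => Nat.rec B (fun _ => f) n
  have hmono : Monotone K := monotone_nat_of_le_succ fun n => Set.subset_union_left
  have hc : ∀ n, (K n).Countable := fun n => by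
    induction n with
    | zero => exact hB
    | succ n ih =>
      have hfin : {s : Finset U | (s : Set U) ⊆ K n}.Countable := by
        refine Set.MapsTo.countable_of_injOn (f := fun s : Finset U => (s : Set U)) ?_
          Finset.coe_injective.injOn (Set.countable_ofPred_finite_subset ih)
        exact fun s hs => ⟨s.finite_toSet, hs⟩
      exact ih.union (hfin.biUnion fun s _ => hg s)
  refine ⟨⋃ n, K n, Set.countable_iUnion hc, Set.subset_iUnion K 0, fun s hs => ?_⟩
  obtain ⟨n, hn⟩ : ∃ n, (s : Set U) ⊆ K n := by
    simpa using hmono.directed_le.exists_mem_subset_of_finset_subset_biUnion (s := s) hs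
  exact fun x hx => Set.mem_iUnion.2 ⟨n + 1, .inr (Set.mem_biUnion (x := s) hn hx)⟩

/-! ### Tuples inside models of pairing -/

section Tuples

variable {M : Type u} {E : M → M → Prop}

theorem IsPair.injective (hp : ∀ a b, ∃ c, ∀ x, E x c ↔ x = a ∨ x = b) {a b a' b' p : M}
    (h : IsPair E a b p) (h' : IsPair E a' b' p) : a = a' ∧ b = b' := by
  obtain ⟨s, hs⟩ := hp a a
  obtain ⟨t, ht⟩ := hp a b
  obtain ⟨t', ht'⟩ := hp a' b'
  have h1 := (h' s).1 ((h s).2 (.inl (by simpa using hs)))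
  have h2 := (h' t).1 ((h t).2 (.inr ht))
  have h3 := (h t').1 ((h' t').2 (.inr ht'))
  simp only [hs, ht, ht', or_self] at h1 h2 h3
  have ha : a = a' := by
    rcases h1 with h1 | h1
    · exact (h1 a).1 rfl
    · exact ((h1 a').2 (.inl rfl)).symm
  subst ha
  refine ⟨rfl, ?_⟩
  have hb : b = a ∨ b = b' :=
    h2.elim (fun h => .inl ((h b).1 (.inr rfl))) fun h => (h b).1 (.inr rfl)
  have hb' : b' = a ∨ b' = b :=
    h3.elim (fun h => .inl ((h b').1 (.inr rfl))) fun h => (h b').1 (.inr rfl)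
  rcases hb with hb | hb
  · rcases hb' with hb' | hb'
    · exact hb.trans hb'.symm
    · exact hb'.symm
  · exact hb

theorem IsTuple.injective (hp : ∀ a b, ∃ c, ∀ x, E x c ↔ x = a ∨ x = b) :
    ∀ {n : ℕ} {x y : Fin n → M} {t : M}, IsTuple E n x t → IsTuple E n y t → x = y
  | 0, x, y, _, _, _ => Subsingleton.elim x y
  | 1, x, y, t, hx, hy => by
    ext j
    rw [Subsingleton.elim j 0]
    exact hx.symm.trans hy
  | n + 2, x, y, t, ⟨p, hxp, hx⟩, ⟨q, hyq, hy⟩ => by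
    obtain ⟨rfl, hlast⟩ := hx.injective hp hy
    rw [← Fin.snoc_init_self x, ← Fin.snoc_init_self y, IsTuple.injective hp hxp hyq, hlast]

/-- Since tuples can be decoded, an `n`-tuple in a relation on `d` has its entries in `d`. -/
theorem IsRelationOn.mem_of_mem_extension (hp : ∀ a b, ∃ c, ∀ x, E x c ↔ x = a ∨ x = b)
    {d r : M} {n : ℕ} (hr : IsRelationOn E d n r) {x : Fin n → M} (hx : x ∈ extension E n r)
    (j : Fin n) : E (x j) d := by
  obtain ⟨t, hxt, htr⟩ := hx
  obtain ⟨y, hy, hyt⟩ := hr t htr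
  rw [hxt.injective hp hyt]
  exact hy j

end Tuples

/-! ### Uniformly definable properties and elementary extensions -/

/-- The membership symbol. -/
def memSymbol : setLanguage.Relations 2 := MemRel.mem

/-- A property of assignments in models of set theory that a single formula, without parameters,
expresses in all structures `(M, E)`. -/
def UniformlyDefinable {α : Type} (P : ∀ M : Type u, (M → M → Prop) → (α → M) → Prop) : Prop :=
  ∃ φ : setLanguage.Formula α, ∀ (M : Type u) (E : M → M → Prop) (v : α → M),
    letI := memStructure E
    φ.Realize v ↔ P M E v

namespace UniformlyDefinable

variable {α : Type}

theorem mem (i j : α) : UniformlyDefinable.{u} fun _ E v => E (v i) (v j) := by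
  refine ⟨memSymbol.formula₂ (.var i) (.var j), fun M E v => ?_⟩
  let _ := memStructure E
  rw [FirstOrder.Language.Formula.realize_rel₂]
  exact Iff.rfl

theorem eq (i j : α) : UniformlyDefinable.{u} fun _ _ v => v i = v j := by
  refine ⟨FirstOrder.Language.Term.equal (.var i) (.var j), fun M E v => ?_⟩
  let _ := memStructure E
  simp

variable {P Q : ∀ M : Type u, (M → M → Prop) → (α → M) → Prop}

theorem not (hP : UniformlyDefinable P) : UniformlyDefinable fun M E v => ¬ P M E v := by
  obtain ⟨φ, hφ⟩ := hP
  refine ⟨φ.not, fun M E v => ?_⟩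
  let _ := memStructure E
  rw [FirstOrder.Language.Formula.realize_not, hφ]

theorem and (hP : UniformlyDefinable P) (hQ : UniformlyDefinable Q) :
    UniformlyDefinable fun M E v => P M E v ∧ Q M E v := by
  obtain ⟨φ, hφ⟩ := hP
  obtain ⟨ψ, hψ⟩ := hQ
  refine ⟨φ ⊓ ψ, fun M E v => ?_⟩
  let _ := memStructure E
  rw [FirstOrder.Language.Formula.realize_inf, hφ, hψ]

theorem or (hP : UniformlyDefinable P) (hQ : UniformlyDefinable Q) :
    UniformlyDefinable fun M E v => P M E v ∨ Q M E v := by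
  simpa only [not_and_or, not_not] using (hP.not.and hQ.not).not

theorem iff (hP : UniformlyDefinable P) (hQ : UniformlyDefinable Q) :
    UniformlyDefinable fun M E v => P M E v ↔ Q M E v := by
  simpa only [iff_iff_and_or_not_and_not] using (hP.and hQ).or (hP.not.and hQ.not)

theorem forall_tuple {β : Type} [Finite β]
    {R : ∀ M : Type u, (M → M → Prop) → (α → M) → (β → M) → Prop}
    (hR : UniformlyDefinable (α := α ⊕ β) fun M E v => R M E (v ∘ .inl) (v ∘ .inr)) :
    UniformlyDefinable fun M E v => ∀ y : β → M, R M E v y := by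
  obtain ⟨φ, hφ⟩ := hR
  refine ⟨φ.iAlls β, fun M E v => ?_⟩
  let _ := memStructure E
  simp only [FirstOrder.Language.Formula.realize_iAlls, hφ, Sum.elim_comp_inl, Sum.elim_comp_inr]

theorem all {R : ∀ M : Type u, (M → M → Prop) → (α → M) → M → Prop}
    (hR : UniformlyDefinable (α := α ⊕ Unit) fun M E v => R M E (v ∘ .inl) (v (.inr ()))) :
    UniformlyDefinable fun M E v => ∀ y, R M E v y := by
  obtain ⟨φ, hφ⟩ := forall_tuple (β := Unit) (R := fun M E v y => R M E v (y ())) hR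
  exact ⟨φ, fun M E v => (hφ M E v).trans ⟨fun h y => h fun _ => y, fun h f => h _⟩⟩

theorem ex {R : ∀ M : Type u, (M → M → Prop) → (α → M) → M → Prop}
    (hR : UniformlyDefinable (α := α ⊕ Unit) fun M E v => R M E (v ∘ .inl) (v (.inr ()))) :
    UniformlyDefinable fun M E v => ∃ y, R M E v y := by
  simpa using (all (R := fun M E v y => ¬ R M E v y) hR.not).not

theorem isPair (a b p : α) : UniformlyDefinable.{u} fun _ E v => IsPair E (v a) (v b) (v p) :=
  all (R := fun _ E v z => E z (v p) ↔ (∀ y, E y z ↔ y = v a) ∨ (∀ y, E y z ↔ y = v a ∨ y = v b))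
    ((mem (Sum.inr ()) (Sum.inl p)).iff
      ((all (α := α ⊕ Unit) (R := fun _ E v y => E y (v (Sum.inr ())) ↔ y = v (Sum.inl a))
          ((mem (Sum.inr ()) (Sum.inl (Sum.inr ()))).iff
            (eq (Sum.inr ()) (Sum.inl (Sum.inl a))))).or
        (all (α := α ⊕ Unit)
          (R := fun _ E v y => E y (v (Sum.inr ())) ↔ y = v (Sum.inl a) ∨ y = v (Sum.inl b))
          ((mem (Sum.inr ()) (Sum.inl (Sum.inr ()))).iff
            ((eq (Sum.inr ()) (Sum.inl (Sum.inl a))).or (eq (Sum.inr ()) (Sum.inl (Sum.inl b))))))))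

theorem isTuple {α : Type} : ∀ {n : ℕ} (e : Fin n → α) (t : α),
    UniformlyDefinable.{u} fun _ E v => IsTuple E n (v ∘ e) (v t)
  | 0, _, t => all (R := fun _ E v y => ¬ E y (v t)) (mem _ _).not
  | 1, e, t => eq t (e 0)
  | n + 2, e, t =>
    ex (R := fun _ E v p => IsTuple E (n + 1) (Fin.init (v ∘ e)) p ∧
        IsPair E p (v (e (Fin.last (n + 1)))) (v t))
      ((isTuple (fun j : Fin (n + 1) => Sum.inl (e j.castSucc)) _).and (isPair _ _ _))

theorem mem_extension {n : ℕ} (e : Fin n → α) (r : α) :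
    UniformlyDefinable.{u} fun _ E v => v ∘ e ∈ extension E n (v r) :=
  ex (R := fun _ E v t => IsTuple E n (v ∘ e) t ∧ E t (v r))
    ((isTuple (fun j => Sum.inl (e j)) _).and (mem _ _))

theorem extension_subset {n : ℕ} (r d : α) (j : Fin n) :
    UniformlyDefinable.{u} fun M E v =>
      ∀ x : Fin n → M, x ∈ extension E n (v r) → E (x j) (v d) := by
  have h := ((mem_extension (α := α ⊕ Fin n) Sum.inr (.inl r)).and (mem (.inr j) (.inl d)).not).not
  simp only [not_and, not_not] at h
  exact forall_tuple (R := fun _ E v x => x ∈ extension E n (v r) → E (x j) (v d)) h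

end UniformlyDefinable

section ElementaryExtension

variable {M U K : Type u} {E : M → M → Prop} {E' : U → U → Prop} {E'' : K → K → Prop}

theorem isElementaryExtension_iff {i : M → K} : IsElementaryExtension E E'' i ↔
    ∀ (n : ℕ) (φ : setLanguage.Formula (Fin n)) (x : Fin n → M),
      (letI := memStructure E''; φ.Realize (i ∘ x)) ↔ (letI := memStructure E; φ.Realize x) := by
  let _ := memStructure E
  let _ := memStructure E''
  constructor
  · rintro ⟨j, rfl⟩ n φ x
    exact j.map_formula' φ x
  · exact fun h => ⟨⟨i, fun {n} φ x => h n φ x⟩, rfl⟩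

theorem IsElementaryExtension.of_comp {i : M → K} {j : K → U}
    (hj : IsElementaryExtension E'' E' j) (hij : IsElementaryExtension E E' (j ∘ i)) :
    IsElementaryExtension E E'' i := by
  rw [isElementaryExtension_iff] at *
  exact fun n φ x => (hj n φ (i ∘ x)).symm.trans (hij n φ x)

theorem IsElementaryExtension.comp {i : M → K} {j : K → U}
    (hj : IsElementaryExtension E'' E' j) (hi : IsElementaryExtension E E'' i) :
    IsElementaryExtension E E' (j ∘ i) := by
  rw [isElementaryExtension_iff] at *
  exact fun n φ x => (hj n φ (i ∘ x)).trans (hi n φ x)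

theorem isElementaryExtension_of_equiv (π : M ≃ U) (h : ∀ x y, E' (π x) (π y) ↔ E x y) :
    IsElementaryExtension E E' π := by
  let _ := memStructure E
  let _ := memStructure E'
  let f : M ≃[setLanguage] U :=
    { π with
      map_fun' := fun f => Empty.elim f
      map_rel' := fun {n} r x => by cases r; exact h _ _ }
  exact ⟨f.toElementaryEmbedding, rfl⟩

theorem UniformlyDefinable.iff_of_isElementaryExtension {α : Type} [Finite α]
    {P : ∀ M : Type u, (M → M → Prop) → (α → M) → Prop} (hP : UniformlyDefinable P)
    {i : M → K} (hi : IsElementaryExtension E E'' i) (v : α → M) :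
    P K E'' (i ∘ v) ↔ P M E v := by
  obtain ⟨φ, hφ⟩ := hP
  obtain ⟨j, rfl⟩ := hi
  rw [← hφ, ← hφ]
  let _ := memStructure E
  let _ := memStructure E''
  exact j.map_formula φ v

/-- Membership in the extension of an object, transferred along an elementary extension. -/
theorem IsElementaryExtension.mem_extension_iff {i : M → K} (hi : IsElementaryExtension E E'' i)
    {n : ℕ} {x : Fin n → M} {r : M} :
    i ∘ x ∈ extension E'' n (i r) ↔ x ∈ extension E n r :=
  (UniformlyDefinable.mem_extension (α := Fin n ⊕ Unit) Sum.inl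
    (.inr ())).iff_of_isElementaryExtension hi (Sum.elim x fun _ => r)

end ElementaryExtension

instance : Countable (Σ n, setLanguage.Functions n) :=
  inferInstanceAs (Countable (Σ _ : ℕ, Empty))

instance : Countable (Σ n, setLanguage.Relations n) := by
  refine Function.Injective.countable (f := Sigma.fst) ?_
  rintro ⟨_, r⟩ ⟨_, s⟩ h
  cases r
  cases s
  rfl

/-- The downward Löwenheim–Skolem theorem, with closure under an additional countably-valued
finitary operation. -/
theorem exists_countable_elementary_closed {U : Type u} (E : U → U → Prop)
    (g : Finset U → Set U) (hg : ∀ s, (g s).Countable) {B : Set U} (hB : B.Countable) :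
    ∃ K : Set U, K.Countable ∧ B ⊆ K ∧ (∀ s : Finset U, (s : Set U) ⊆ K → g s ⊆ K) ∧
      IsElementaryExtension (fun a b : K => E a b) E Subtype.val := by
  let _ := memStructure E
  have : Countable setLanguage.Symbols := inferInstanceAs (Countable (_ ⊕ _))
  have : Countable (Σ n, setLanguage.BoundedFormula Empty (n + 1)) :=
    Function.Injective.countable (β := Σ n, setLanguage.BoundedFormula Empty n)
      (f := fun p => ⟨p.1 + 1, p.2⟩) fun ⟨n, φ⟩ ⟨m, ψ⟩ h => by
        obtain ⟨h₁, h₂⟩ := Sigma.mk.inj h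
        obtain rfl : n = m := Nat.succ.inj h₁
        exact congrArg _ (eq_of_heq h₂)
  have wit : ∀ (p : Σ n, setLanguage.BoundedFormula Empty (n + 1)) (x : Fin p.1 → U),
      ∃ W : Set U, W.Countable ∧ ∀ a, p.2.Realize default (Fin.snoc x a : Fin (p.1 + 1) → U) →
        ∃ b ∈ W, p.2.Realize default (Fin.snoc x b : Fin (p.1 + 1) → U) := fun p x => by
    by_cases h : ∃ b, p.2.Realize default (Fin.snoc x b : Fin (p.1 + 1) → U)
    · obtain ⟨b, hb⟩ := h
      exact ⟨{b}, Set.countable_singleton b, fun _ _ => ⟨b, rfl, hb⟩⟩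
    · exact ⟨∅, Set.countable_empty, fun a ha => (h ⟨a, ha⟩).elim⟩
  choose W hWc hW using wit
  obtain ⟨K, hK, hBK, hcl⟩ := exists_countable_closed
    (fun s => g s ∪ ⋃ p : Σ n, setLanguage.BoundedFormula Empty (n + 1),
      ⋃ x : Fin p.1 → s, W p (Subtype.val ∘ x))
    (fun s => (hg s).union <| Set.countable_iUnion fun p => Set.countable_iUnion fun x => hWc _ _)
    hB
  refine ⟨K, hK, hBK, fun s hs => Set.subset_union_left.trans (hcl s hs), ?_⟩
  let _ : setLanguage.Structure K := memStructure fun a b : K => E a b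
  let f : K ↪[setLanguage] U :=
    { toFun := Subtype.val
      inj' := Subtype.val_injective
      map_fun' := fun f => Empty.elim f
      map_rel' := fun r x => by cases r; exact Iff.rfl }
  refine ⟨f.toElementaryEmbedding fun n φ x a ha => ?_, rfl⟩
  classical
  let s : Finset U := Finset.univ.image fun j => (x j : U)
  obtain ⟨b, hb, hφ⟩ := hW ⟨n, φ⟩ (f ∘ x) a ha
  refine ⟨⟨b, hcl s (by simp [s, Set.range_subset_iff]) (.inr ?_)⟩, hφ⟩
  exact Set.mem_iUnion₂.2 ⟨⟨n, φ⟩, fun j => ⟨x j, by simp [s]⟩, hb⟩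

/-! ### Ultrapowers of models of set theory -/

section Ultrapower

open Filter

variable {M : Type u} (𝒰 : Ultrafilter ℕ) (E : M → M → Prop)

variable (M) in
/-- The underlying set of the ultrapower of `M` by `𝒰`. -/
def Ultrapower : Type u := (𝒰 : Filter ℕ).Product fun _ => M

/-- The element of the ultrapower that a sequence represents. -/
def ultraMk (x : ℕ → M) : Ultrapower M 𝒰 := Quotient.mk _ x

theorem ultraMk_surjective : Function.Surjective (ultraMk (M := M) 𝒰) := Quotient.mk_surjective

theorem ultraMk_eq_iff {x y : ℕ → M} : ultraMk 𝒰 x = ultraMk 𝒰 y ↔ ∀ᶠ n in 𝒰, x n = y n :=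
  Quotient.eq

/-- The ultrapower of `(M, E)` by `𝒰`, as a structure in the language of set theory. -/
@[reducible] def ultraStructure : setLanguage.Structure (Ultrapower M 𝒰) :=
  @FirstOrder.Language.Ultraproduct.structure ℕ (fun _ => M) 𝒰 setLanguage fun _ => memStructure E

/-- The membership relation of the ultrapower of `(M, E)` by `𝒰`. -/
def ultraMem : Ultrapower M 𝒰 → Ultrapower M 𝒰 → Prop :=
  fun a b => (ultraStructure 𝒰 E).RelMap memSymbol ![a, b]

variable {E}

theorem realize_ultraMem_iff [Nonempty M] {α : Type} (φ : setLanguage.Formula α) (x : α → ℕ → M) :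
    (letI := memStructure (ultraMem 𝒰 E); φ.Realize fun i => ultraMk 𝒰 (x i)) ↔
      ∀ᶠ n in 𝒰, (letI := memStructure E; φ.Realize fun i => x i n) := by
  have h : memStructure (ultraMem 𝒰 E) = ultraStructure 𝒰 E := by
    ext n f x
    · exact Empty.elim f
    · cases f
      refine iff_of_eq (congrArg ((ultraStructure 𝒰 E).RelMap memSymbol) ?_)
      ext j
      fin_cases j <;> rfl
  rw [h]
  exact @FirstOrder.Language.Ultraproduct.realize_formula_cast ℕ (fun _ => M) 𝒰 setLanguage
    (fun _ => memStructure E) _ α φ x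

/-- Łoś's theorem for uniformly definable properties. -/
theorem UniformlyDefinable.ultraMem_iff [Nonempty M] {α : Type}
    {P : ∀ M : Type u, (M → M → Prop) → (α → M) → Prop} (hP : UniformlyDefinable P)
    (x : α → ℕ → M) :
    P _ (ultraMem 𝒰 E) (fun i => ultraMk 𝒰 (x i)) ↔ ∀ᶠ n in 𝒰, P M E fun i => x i n := by
  obtain ⟨φ, hφ⟩ := hP
  simp_rw [← hφ]
  exact realize_ultraMem_iff 𝒰 φ x

theorem ultraMem_mk_iff [Nonempty M] {x y : ℕ → M} :
    ultraMem 𝒰 E (ultraMk 𝒰 x) (ultraMk 𝒰 y) ↔ ∀ᶠ n in 𝒰, E (x n) (y n) :=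
  (UniformlyDefinable.mem (0 : Fin 2) 1).ultraMem_iff 𝒰 ![x, y]

theorem mem_extension_ultraMem_iff [Nonempty M] {n : ℕ} {x : Fin n → ℕ → M} {r : ℕ → M} :
    (fun j => ultraMk 𝒰 (x j)) ∈ extension (ultraMem 𝒰 E) n (ultraMk 𝒰 r) ↔
      ∀ᶠ m in 𝒰, (fun j => x j m) ∈ extension E n (r m) :=
  (UniformlyDefinable.mem_extension (α := Fin n ⊕ Unit) Sum.inl (.inr ())).ultraMem_iff 𝒰
    (Sum.elim x fun _ => r)

theorem isElementaryExtension_ultraMem [Nonempty M] :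
    IsElementaryExtension E (ultraMem 𝒰 E) fun m => ultraMk 𝒰 fun _ => m := by
  rw [isElementaryExtension_iff]
  exact fun n φ x => (realize_ultraMem_iff 𝒰 φ fun i _ => x i).trans Filter.eventually_const

end Ultrapower

/-! ### Back-and-forth in the ultrapower -/

section UltraRank

open Filter

variable {M : Type u} {E : M → M → Prop} {d : M}

/-- The element of the ultrapower represented by a sequence of elements of `d`. -/
def ultraElem (𝒰 : Ultrafilter ℕ) (s : ℕ → {x // E x d}) : Ultrapower M 𝒰 :=
  ultraMk 𝒰 fun m => s m

open Classical in
/-- A sequence of elements of `d` representing `x`, if `x` is an element of `d` in the ultrapower.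
The element `a₀` replaces the terms outside of `d` of the chosen representative. -/
noncomputable def ultraRep {𝒰 : Ultrafilter ℕ} (a₀ : {x // E x d}) (x : Ultrapower M 𝒰) (m : ℕ) :
    {x // E x d} :=
  if h : E (Function.surjInv (ultraMk_surjective 𝒰) x m) d then ⟨_, h⟩ else a₀

variable {𝒰 : Ultrafilter ℕ} (a₀ : {x // E x d})

theorem eventually_ultraRep_ultraElem (s : ℕ → {x // E x d}) :
    ∀ᶠ m in 𝒰, ultraRep a₀ (ultraElem 𝒰 s) m = s m := by
  have h := (ultraMk_eq_iff 𝒰).1 (Function.surjInv_eq (ultraMk_surjective 𝒰) (ultraElem 𝒰 s))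
  filter_upwards [h] with m hm
  apply Subtype.ext
  rw [ultraRep, dif_pos (hm ▸ (s m).2)]
  exact hm

theorem ultraElem_ultraRep [Nonempty M] {x : Ultrapower M 𝒰}
    (hx : ultraMem 𝒰 E x (ultraMk 𝒰 fun _ => d)) : ultraElem 𝒰 (ultraRep a₀ x) = x := by
  have hs := Function.surjInv_eq (ultraMk_surjective 𝒰) x
  have h : ∀ᶠ m in 𝒰, E (Function.surjInv (ultraMk_surjective 𝒰) x m) d := by
    rwa [← hs, ultraMem_mk_iff] at hx
  conv_rhs => rw [← hs]
  refine (ultraMk_eq_iff 𝒰).2 ?_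
  filter_upwards [h] with m hm
  rw [ultraRep, dif_pos hm]

theorem ultraElem_mem [Nonempty M] (s : ℕ → {x // E x d}) :
    ultraMem 𝒰 E (ultraElem 𝒰 s) (ultraMk 𝒰 fun _ => d) :=
  (ultraMem_mk_iff 𝒰).2 (.of_forall fun m => (s m).2)

theorem eq_ultraElem_iff [Nonempty M] {x : Ultrapower M 𝒰}
    (hx : ultraMem 𝒰 E x (ultraMk 𝒰 fun _ => d)) (s : ℕ → {x // E x d}) :
    x = ultraElem 𝒰 s ↔ ∀ᶠ m in 𝒰, ultraRep a₀ x m = s m := by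
  conv_lhs => rw [← ultraElem_ultraRep a₀ hx]
  simp only [ultraElem, ultraMk_eq_iff, Subtype.ext_iff]

/-- The position `l` in the ultrapower is represented by positions in `d` from which the second
player survives longer and longer games for more and more of the relations `q 0, q 1, …`. -/
def UltraEquiv (q : ℕ → Σ n, Set (Fin n → {x // E x d}))
    (l : List (Ultrapower M 𝒰 × Ultrapower M 𝒰)) : Prop :=
  ∀ᶠ m in 𝒰, RankEquiv (q '' Set.Iio m) (m - l.length)
    (l.map fun p => (ultraRep a₀ p.1 m, ultraRep a₀ p.2 m))

variable {a₀} {q : ℕ → Σ n, Set (Fin n → {x // E x d})}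
  {l : List (Ultrapower M 𝒰 × Ultrapower M 𝒰)}

/-- The second player can answer any element of the ultrapower: each move costs one round at every
stage, and the stages with a round left are in the ultrafilter. -/
theorem UltraEquiv.forth (h𝒰 : (𝒰 : Filter ℕ) ≤ atTop) (h : UltraEquiv a₀ q l)
    (c : Ultrapower M 𝒰) : ∃ s : ℕ → {x // E x d}, UltraEquiv a₀ q ((c, ultraElem 𝒰 s) :: l) := by
  have key : ∀ m, ∃ b, m > l.length → RankEquiv (q '' Set.Iio m) (m - l.length)
      (l.map fun p => (ultraRep a₀ p.1 m, ultraRep a₀ p.2 m)) →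
      RankEquiv (q '' Set.Iio m) (m - (l.length + 1))
        ((ultraRep a₀ c m, b) :: l.map fun p => (ultraRep a₀ p.1 m, ultraRep a₀ p.2 m)) := by
    intro m
    by_cases hm : m > l.length ∧ RankEquiv (q '' Set.Iio m) (m - l.length)
      (l.map fun p => (ultraRep a₀ p.1 m, ultraRep a₀ p.2 m))
    · obtain ⟨hm, hr⟩ := hm
      rw [show m - l.length = m - (l.length + 1) + 1 by omega] at hr
      exact (hr.2.1 _).imp fun b hb _ _ => hb
    · exact ⟨a₀, fun h1 h2 => (hm ⟨h1, h2⟩).elim⟩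
  choose s hs using key
  refine ⟨s, ?_⟩
  filter_upwards [h, h𝒰 (eventually_gt_atTop l.length), eventually_ultraRep_ultraElem a₀ s]
    with m h1 h2 h3
  simpa [h3] using hs m h2 h1

theorem UltraEquiv.back (h𝒰 : (𝒰 : Filter ℕ) ≤ atTop) (h : UltraEquiv a₀ q l)
    (c : Ultrapower M 𝒰) : ∃ s : ℕ → {x // E x d}, UltraEquiv a₀ q ((ultraElem 𝒰 s, c) :: l) := by
  have key : ∀ m, ∃ b, m > l.length → RankEquiv (q '' Set.Iio m) (m - l.length)
      (l.map fun p => (ultraRep a₀ p.1 m, ultraRep a₀ p.2 m)) →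
      RankEquiv (q '' Set.Iio m) (m - (l.length + 1))
        ((b, ultraRep a₀ c m) :: l.map fun p => (ultraRep a₀ p.1 m, ultraRep a₀ p.2 m)) := by
    intro m
    by_cases hm : m > l.length ∧ RankEquiv (q '' Set.Iio m) (m - l.length)
      (l.map fun p => (ultraRep a₀ p.1 m, ultraRep a₀ p.2 m))
    · obtain ⟨hm, hr⟩ := hm
      rw [show m - l.length = m - (l.length + 1) + 1 by omega] at hr
      exact (hr.2.2 _).imp fun b hb _ _ => hb
    · exact ⟨a₀, fun h1 h2 => (hm ⟨h1, h2⟩).elim⟩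
  choose s hs using key
  refine ⟨s, ?_⟩
  filter_upwards [h, h𝒰 (eventually_gt_atTop l.length), eventually_ultraRep_ultraElem a₀ s]
    with m h1 h2 h3
  simpa [h3] using hs m h2 h1

/-- Each single relation `q i` is preserved, because almost all stages are beyond `i`. -/
theorem UltraEquiv.eventually_iff (h𝒰 : (𝒰 : Filter ℕ) ≤ atTop) (h : UltraEquiv a₀ q l)
    {n : ℕ} {X : Set (Fin n → {x // E x d})} (hX : ⟨n, X⟩ ∈ Set.range q)
    {x y : Fin n → Ultrapower M 𝒰} (hl : ∀ j, (x j, y j) ∈ l) :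
    ∀ᶠ m in 𝒰, ((fun j => ultraRep a₀ (x j) m) ∈ X ↔ (fun j => ultraRep a₀ (y j) m) ∈ X) := by
  obtain ⟨i, hi⟩ := hX
  filter_upwards [h, h𝒰 (eventually_gt_atTop i)] with m hm him
  exact hm.atomEquiv ⟨n, X⟩ ⟨i, him, hi⟩ (fun j => (ultraRep a₀ (x j) m, ultraRep a₀ (y j) m))
    fun j => List.mem_map.2 ⟨_, hl j, rfl⟩

end UltraRank

/-! ### The extension with a permutation of the elements of `d` -/

/-- The extension of the object `r` as an `n`-ary relation, restricted to the elements of `d`. -/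
def relationOn {M : Type u} (E : M → M → Prop) (d : M) (n : ℕ) (r : M) :
    Set (Fin n → {x // E x d}) :=
  {x | (fun j => (x j : M)) ∈ extension E n r}

/-- The relations on the elements of `d` to be preserved: the ones in the given set `R` of objects
with arities, as well as equality and all singletons. -/
def preservedRelations {M : Type u} (E : M → M → Prop) (d : M) (R : Set (ℕ × M)) :
    Set (Σ n, Set (Fin n → {x // E x d})) :=
  (fun p => ⟨p.1, relationOn E d p.1 p.2⟩) '' R ∪
    insert ⟨2, {x | x 0 = x 1}⟩ (Set.range fun a => ⟨1, {x | x 0 = a}⟩)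

open Filter in
/-- If `S` splits classes of all finite ranks for finite sets of preserved relations, then some
elementary extension has a permutation that fixes the ground model pointwise, leaves `d` invariant
and preserves the relations on it, but moves a tuple in `S` to one outside of `S`. -/
theorem exists_elementaryExtension_perm {M : Type u} [Countable M] (E : M → M → Prop) (d S : M)
    (k : ℕ) (R : Set (ℕ × M))
    (hS : ∀ Q ⊆ preservedRelations E d R, Q.Finite → ∀ r, ∃ x ∈ relationOn E d k S,
      ∃ y ∉ relationOn E d k S, RankEquiv Q r (List.ofFn fun i => (x i, y i))) :
    ∃ (K : Type u) (E' : K → K → Prop) (i : M → K) (π : K ≃ K),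
      IsElementaryExtension E E' i ∧ (∀ m, π (i m) = i m) ∧
      (∀ x, E' (π x) (i d) ↔ E' x (i d)) ∧
      (∀ n r, (n, r) ∈ R → ∀ x : Fin n → K, (∀ j, E' (x j) (i d)) →
        (π ∘ x ∈ extension E' n (i r) ↔ x ∈ extension E' n (i r))) ∧
      ∃ a ∈ extension E' k (i S), π ∘ a ∉ extension E' k (i S) := by
  classical
  obtain ⟨x₀, hx₀, y₀, hy₀, -⟩ := hS ∅ (Set.empty_subset _) Set.finite_empty 0
  obtain ⟨j₀, -⟩ := Function.ne_iff.1 (ne_of_mem_of_not_mem hx₀ hy₀)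
  let a₀ := x₀ j₀
  have : Nonempty M := ⟨a₀.1⟩
  have hc : (preservedRelations E d R).Countable :=
    (R.to_countable.image _).union ((Set.countable_range _).insert _)
  obtain ⟨q, hq⟩ := hc.exists_eq_range ⟨_, .inr (.inl rfl)⟩
  -- The position `(a, b)` has length `k`, so `m - k` is the rank that `UltraEquiv` asks for.
  have hsplit := fun m : ℕ => hS (q '' Set.Iio m) (hq ▸ Set.image_subset_range _ _)
    ((Set.finite_Iio m).image _) (m - k)
  choose a ha b hb hab using hsplit
  let 𝒰 : Ultrafilter ℕ := hyperfilter ℕ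
  have h𝒰 : (𝒰 : Filter ℕ) ≤ atTop := Nat.hyperfilter_le_atTop
  let U := Ultrapower M 𝒰
  let δ : M → U := fun m => ultraMk 𝒰 fun _ => m
  have hδ : IsElementaryExtension E (ultraMem 𝒰 E) δ := isElementaryExtension_ultraMem 𝒰
  let aU : Fin k → U := fun j => ultraElem 𝒰 fun m => a m j
  let bU : Fin k → U := fun j => ultraElem 𝒰 fun m => b m j
  have hforth : ∀ (l : List (U × U)) (c : U), ∃ s : ℕ → {x // E x d}, UltraEquiv a₀ q l →
      UltraEquiv a₀ q ((c, ultraElem 𝒰 s) :: l) := fun l c => by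
    by_cases h : UltraEquiv a₀ q l
    · exact (h.forth h𝒰 c).imp fun s hs _ => hs
    · exact ⟨fun _ => a₀, fun h' => (h h').elim⟩
  have hback : ∀ (l : List (U × U)) (c : U), ∃ s : ℕ → {x // E x d}, UltraEquiv a₀ q l →
      UltraEquiv a₀ q ((ultraElem 𝒰 s, c) :: l) := fun l c => by
    by_cases h : UltraEquiv a₀ q l
    · exact (h.back h𝒰 c).imp fun s hs _ => hs
    · exact ⟨fun _ => a₀, fun h' => (h h').elim⟩
  choose fw hfw using hforth
  choose bw hbw using hback
  obtain ⟨K, hK, hBK, hcl, hval⟩ := exists_countable_elementary_closed (ultraMem 𝒰 E)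
    (fun s => Set.range (fun p : List (s × s) × s =>
        ultraElem 𝒰 (fw (p.1.map (Prod.map Subtype.val Subtype.val)) p.2)) ∪
      Set.range (fun p : List (s × s) × s =>
        ultraElem 𝒰 (bw (p.1.map (Prod.map Subtype.val Subtype.val)) p.2)))
    (fun s => (Set.countable_range _).union (Set.countable_range _))
    (B := Set.range δ ∪ (Set.range aU ∪ Set.range bU))
    ((Set.countable_range _).union ((Set.countable_range _).union (Set.countable_range _)))
  have := hK.to_subtype
  let E' : K → K → Prop := fun x y => ultraMem 𝒰 E x y
  let i : M → K := fun m => ⟨δ m, hBK (.inl ⟨m, rfl⟩)⟩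
  have hi : IsElementaryExtension E E' i := hval.of_comp hδ
  let D := {x : K // E' x (i d)}
  let val : D → U := fun x => x.1.1
  have hvalD : ∀ x : D, ultraMem 𝒰 E (val x) (ultraMk 𝒰 fun _ => d) := fun x => x.2
  have hval_inj : Function.Injective val := Subtype.val_injective.comp Subtype.val_injective
  -- Finite sets of elements of `D` lie in finite subsets of `K`, to which the closure of `K`
  -- under the back-and-forth operations applies.
  have hlift : ∀ (l : List (D × D)) (c : D), ∃ s : Finset U, (s : Set U) ⊆ K ∧
      ∃ p : List (s × s) × s, p.1.map (Prod.map Subtype.val Subtype.val) =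
        l.map (Prod.map val val) ∧ (p.2 : U) = val c := by
    intro l c
    let s : Finset U := insert (val c) ((l.map fun p => val p.1).toFinset ∪
      (l.map fun p => val p.2).toFinset)
    have hsK : (s : Set U) ⊆ K := by
      intro x hx
      simp only [s, Finset.coe_insert, Finset.coe_union, List.coe_toFinset, List.mem_map,
        Set.mem_insert_iff, Set.mem_union, Set.mem_ofPred_eq] at hx
      rcases hx with rfl | ⟨p, -, rfl⟩ | ⟨p, -, rfl⟩
      · exact c.1.2
      · exact p.1.1.2
      · exact p.2.1.2
    refine ⟨s, hsK,
      ⟨l.attach.map fun p => (⟨val p.1.1, ?_⟩, ⟨val p.1.2, ?_⟩), ⟨val c, ?_⟩⟩, ?_, rfl⟩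
    · simp only [s, Finset.mem_insert, Finset.mem_union, List.mem_toFinset, List.mem_map]
      exact .inr (.inl ⟨_, p.2, rfl⟩)
    · simp only [s, Finset.mem_insert, Finset.mem_union, List.mem_toFinset, List.mem_map]
      exact .inr (.inr ⟨_, p.2, rfl⟩)
    · simp [s]
    · rw [List.map_map]
      exact List.attach_map_val (f := Prod.map val val)
  let G : List (D × D) → Prop := fun l => UltraEquiv a₀ q (l.map (Prod.map val val))
  have hGforth : ∀ l, G l → ∀ c, ∃ d, G ((c, d) :: l) := by
    intro l hl c
    obtain ⟨s, hsK, p, hp1, hp2⟩ := hlift l c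
    have hmem : ultraElem 𝒰 (fw (l.map (Prod.map val val)) (val c)) ∈ K :=
      hcl s hsK (.inl ⟨p, congrArg₂ (fun l c => ultraElem 𝒰 (fw l c)) hp1 hp2⟩)
    exact ⟨⟨⟨_, hmem⟩, ultraElem_mem _⟩, hfw _ _ hl⟩
  have hGback : ∀ l, G l → ∀ d, ∃ c, G ((c, d) :: l) := by
    intro l hl c
    obtain ⟨s, hsK, p, hp1, hp2⟩ := hlift l c
    have hmem : ultraElem 𝒰 (bw (l.map (Prod.map val val)) (val c)) ∈ K :=
      hcl s hsK (.inr ⟨p, congrArg₂ (fun l c => ultraElem 𝒰 (bw l c)) hp1 hp2⟩)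
    exact ⟨⟨⟨_, hmem⟩, ultraElem_mem _⟩, hbw _ _ hl⟩
  let aD : Fin k → D := fun j => ⟨⟨aU j, hBK (.inr (.inl ⟨j, rfl⟩))⟩, ultraElem_mem _⟩
  let bD : Fin k → D := fun j => ⟨⟨bU j, hBK (.inr (.inr ⟨j, rfl⟩))⟩, ultraElem_mem _⟩
  have hG₀ : G (List.ofFn fun j => (aD j, bD j)) := by
    have h1 := fun j => eventually_ultraRep_ultraElem (𝒰 := 𝒰) a₀ fun m => a m j
    have h2 := fun j => eventually_ultraRep_ultraElem (𝒰 := 𝒰) a₀ fun m => b m j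
    filter_upwards [eventually_all.2 h1, eventually_all.2 h2] with m h1 h2
    convert hab m using 1
    · simp
    · simp only [List.map_ofFn]
      congr 1
      funext j
      exact Prod.ext (h1 j) (h2 j)
  obtain ⟨C, hC₀, hCl, hCr, hC⟩ := exists_correspondence_of_backAndForth G hGforth hGback _ hG₀
  have hCrel : ∀ {n : ℕ} {X : Set (Fin n → {x // E x d})}, ⟨n, X⟩ ∈ preservedRelations E d R →
      ∀ x y : Fin n → D, (∀ j, (x j, y j) ∈ C) → ∀ᶠ m in 𝒰,
        ((fun j => ultraRep a₀ (val (x j)) m) ∈ X ↔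
          (fun j => ultraRep a₀ (val (y j)) m) ∈ X) := by
    intro n X hX x y hxy
    obtain ⟨l', hl', hsub⟩ := hC (List.ofFn fun j => (x j, y j)) (by simpa using hxy)
    refine hl'.eventually_iff h𝒰 (hq ▸ hX) (x := fun j => val (x j)) (y := fun j => val (y j))
      fun j => List.mem_map.2 ⟨(x j, y j), hsub ((List.mem_ofFn' _ _).2 ⟨j, rfl⟩), rfl⟩
  have hDeq : ∀ x y : D, x = y ↔
      ∀ᶠ m in 𝒰, ultraRep a₀ (val x) m = ultraRep a₀ (val y) m := by
    intro x y
    rw [← hval_inj.eq_iff, ← eq_ultraElem_iff a₀ (hvalD x), ultraElem_ultraRep a₀ (hvalD y)]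
  have hCeq : ∀ {x y x' y' : D}, (x, y) ∈ C → (x', y') ∈ C → (x = x' ↔ y = y') := by
    intro x y x' y' h h'
    rw [hDeq, hDeq]
    refine eventually_congr ?_
    exact hCrel (X := {x | x 0 = x 1}) (.inr (.inl rfl)) ![x, x'] ![y, y']
      (Fin.forall_fin_two.2 ⟨h, h'⟩)
  choose f hf using hCl
  choose g hg using hCr
  let πD : Equiv.Perm D :=
    ⟨f, g, fun x => (hCeq (hg (f x)) (hf x)).2 rfl, fun y => (hCeq (hf (g y)) (hg y)).1 rfl⟩
  let π : Equiv.Perm K := Equiv.Perm.ofSubtype πD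
  have hπ : ∀ x : D, π x.1 = (f x).1 := fun x => Equiv.Perm.ofSubtype_apply_coe πD x
  have hπ' : ∀ x : K, ¬ E' x (i d) → π x = x := fun x hx =>
    Equiv.Perm.ofSubtype_apply_of_not_mem πD hx
  have hext : ∀ {n : ℕ} {r : M} (x : Fin n → D), (fun j => (x j).1) ∈ extension E' n (i r) ↔
      ∀ᶠ m in 𝒰, (fun j => ultraRep a₀ (val (x j)) m) ∈ relationOn E d n r := by
    intro n r x
    have h := mem_extension_ultraMem_iff 𝒰 (E := E) (r := fun _ => r)
      (x := fun (j : Fin n) m => (ultraRep a₀ (val (x j)) m : M))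
    refine Iff.trans ?_ h
    rw [← hval.mem_extension_iff]
    have : (fun j => ultraMk 𝒰 fun m => (ultraRep a₀ (val (x j)) m : M)) = fun j => val (x j) :=
      funext fun j => ultraElem_ultraRep a₀ (hvalD (x j))
    rw [this]
    exact Iff.rfl
  refine ⟨K, E', i, π, hi, fun m => ?_, fun x => ?_, fun n r hr x hx => ?_,
    fun j => (aD j).1, ?_, ?_⟩
  · by_cases hm : E' (i m) (i d)
    · have hmd : E m d := ((UniformlyDefinable.mem (0 : Fin 2) 1).iff_of_isElementaryExtension hi
        ![m, d]).1 hm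
      let x : D := ⟨i m, hm⟩
      have h1 : ∀ᶠ n in 𝒰, ultraRep a₀ (val x) n = ⟨m, hmd⟩ :=
        eventually_ultraRep_ultraElem a₀ fun _ => ⟨m, hmd⟩
      have h2 := hCrel (X := {x | x 0 = ⟨m, hmd⟩}) (.inr (.inr ⟨_, rfl⟩)) (fun _ => x)
        (fun _ => f x) fun _ => hf x
      have : f x = x := by
        rw [hDeq]
        filter_upwards [h1, h2] with n h1 h2
        rw [h1]
        exact h2.1 h1
      exact (hπ x).trans (congrArg _ this)
    · exact hπ' _ hm
  · by_cases hx : E' x (i d)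
    · exact iff_of_true ((hπ ⟨x, hx⟩).symm ▸ (f ⟨x, hx⟩).2) hx
    · rw [hπ' x hx]
  · have h1 : π ∘ x = fun j => (f ⟨x j, hx j⟩).1 := funext fun j => hπ ⟨x j, hx j⟩
    rw [h1, hext, hext (r := r) (fun j => ⟨x j, hx j⟩)]
    refine eventually_congr ?_
    filter_upwards [hCrel (.inl ⟨_, hr, rfl⟩) (fun j => ⟨x j, hx j⟩) _ fun j => hf _] with m hm
    exact hm.symm
  · rw [hext]
    filter_upwards [eventually_all.2 fun j =>
      eventually_ultraRep_ultraElem (𝒰 := 𝒰) a₀ fun m => a m j] with m hm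
    exact (funext hm : _ = a m) ▸ ha m
  · have h1 : π ∘ (fun j => (aD j).1) = fun j => (bD j).1 := funext fun j => by
      have : f (aD j) = bD j :=
        (hCeq (hf (aD j)) (hC₀ (aD j, bD j) ((List.mem_ofFn' _ _).2 ⟨j, rfl⟩))).1 rfl
      exact (hπ (aD j)).trans (congrArg _ this)
    rw [h1, hext, ← Ultrafilter.eventually_not]
    filter_upwards [eventually_all.2 fun j =>
      eventually_ultraRep_ultraElem (𝒰 := 𝒰) a₀ fun m => b m j] with m hm
    exact (funext hm : _ = b m) ▸ hb m

/-! ### Structures inside a model -/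

section Definable

variable {A : Type*} {L : FirstOrder.Language.{v, w}} [L.Structure A] (P : Set A) {n : ℕ}

theorem definable_relMap (r : L.Relations n) :
    P.Definable L {x | FirstOrder.Language.Structure.RelMap r x} := by
  refine Set.Definable.mono (Set.empty_definable_iff.2 ⟨r.formula fun j => .var j, ?_⟩)
    (Set.empty_subset _)
  ext x
  change _ ↔ FirstOrder.Language.Formula.Realize _ x
  rw [FirstOrder.Language.Formula.realize_rel]
  exact Iff.rfl

theorem definable_graph_funMap (f : L.Functions n) :
    P.Definable L {x : Fin (n + 1) → A |
      FirstOrder.Language.Structure.funMap f (Fin.init x) = x (Fin.last n)} := by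
  refine Set.Definable.mono (Set.empty_definable_iff.2
    ⟨(FirstOrder.Language.Term.func f fun j => .var j.castSucc).equal (.var (Fin.last n)), ?_⟩)
    (Set.empty_subset _)
  ext x
  change _ ↔ FirstOrder.Language.Formula.Realize _ x
  rw [FirstOrder.Language.Formula.realize_equal]
  exact Iff.rfl

end Definable

namespace ObjectStructure

variable {M : Type u} {E : M → M → Prop} {L : FirstOrder.Language.{v, w}} {N : ObjectStructure L M}

theorem mem_relationOn_fn_iff (hN : N.IsStructureIn E) {n : ℕ} (f : L.Functions n)
    (x : Fin (n + 1) → {x // E x N.dom}) :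
    letI : L.Structure {x // E x N.dom} := N.toStructure E hN
    x ∈ relationOn E N.dom (n + 1) (N.fn f) ↔
      FirstOrder.Language.Structure.funMap f (Fin.init x) = x (Fin.last n) := by
  let _ : L.Structure {x // E x N.dom} := N.toStructure E hN
  have h := (hN.isFunctionOn f).2 (fun j => (x j.castSucc : M)) fun j => (x j.castSucc).2
  have hsnoc : (fun j => (x j : M)) =
      (Fin.snoc (fun j => (x j.castSucc : M)) (x (Fin.last n)) : Fin (n + 1) → M) :=
    (Fin.snoc_init_self fun j => (x j : M)).symm
  have hval : (FirstOrder.Language.Structure.funMap f (Fin.init x) : {x // E x N.dom}).1 =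
      h.choose := rfl
  rw [Subtype.ext_iff, hval]
  constructor
  · intro hx
    exact h.unique h.choose_spec.1 ⟨(x (Fin.last n)).2, hsnoc ▸ hx⟩
  · intro hx
    change (fun j => (x j : M)) ∈ extension E (n + 1) (N.fn f)
    rw [hsnoc, ← hx]
    exact h.choose_spec.1.2

end ObjectStructure

section Isomorphism

variable {M K : Type u} {E : M → M → Prop} {E' : K → K → Prop}

theorem mem_extension_iff_of_equiv (π : M ≃ K) (h : ∀ x y, E' (π x) (π y) ↔ E x y) {n : ℕ}
    {x : Fin n → M} {r : M} : π ∘ x ∈ extension E' n (π r) ↔ x ∈ extension E n r :=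
  (isElementaryExtension_of_equiv π h).mem_extension_iff

end Isomorphism

theorem theorem6 {M : Type u} [Countable M] (E : M → M → Prop) (hM : IsModelOfZFC E)
    (L : FirstOrder.Language.{v, w}) [Finite L.Symbols]
    (N : ObjectStructure L M) (hN : N.IsStructureIn E)
    (k : ℕ) (S : M) (hS : IsRelationOn E N.dom k S) (hdef : ¬ N.IsDefinablePredicate E hN k S) :
    ∃ (K : Type u) (E₁ E₂ : K → K → Prop) (i : M → K),
      IsElementaryExtension E E₁ i ∧ IsElementaryExtension E E₂ i ∧
      (N.map i).SameStructure E₁ E₂ ∧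
      extension E₁ k (i S) ≠ extension E₂ k (i S) := by
  let _ : L.Structure {x // E x N.dom} := N.toStructure E hN
  let R : Set (ℕ × M) := Set.range (fun p : Σ n, L.Functions n => (p.1 + 1, N.fn p.2)) ∪
    Set.range (fun p : Σ n, L.Relations n => (p.1, N.rel p.2))
  have hdefQ : ∀ q ∈ preservedRelations E N.dom R,
      (Set.univ : Set {x // E x N.dom}).Definable L q.2 := by
    rintro _ (⟨_, ⟨p, rfl⟩ | ⟨p, rfl⟩, rfl⟩ | rfl | ⟨a, rfl⟩)
    · have h := definable_graph_funMap Set.univ p.2 (A := {x // E x N.dom})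
      rw [← Set.ext (ObjectStructure.mem_relationOn_fn_iff hN p.2)] at h
      exact h
    · exact definable_relMap Set.univ p.2 (A := {x // E x N.dom})
    · exact Set.Definable.diagonal L Set.univ
    · exact Set.Definable.singleton_of_mem L (Set.mem_univ a)
  obtain ⟨K, E₁, i, π, hi, hπi, hπd, hπR, a, ha, hπa⟩ :=
    exists_elementaryExtension_perm E N.dom S k R fun Q hQ hfin r =>
      exists_rankEquiv_of_not_definable hfin (fun q hq => hdefQ q (hQ hq)) r hdef
  -- The second membership relation is the pullback of the first along the permutation.
  let E₂ : K → K → Prop := fun x y => E₁ (π x) (π y)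
  have hext : ∀ {n : ℕ} {x : Fin n → K} (r : M),
      x ∈ extension E₂ n (i r) ↔ π ∘ x ∈ extension E₁ n (i r) := fun {n x} r => by
    rw [← mem_extension_iff_of_equiv (E := E₂) (E' := E₁) π fun _ _ => Iff.rfl, hπi]
  -- As extensions consist of tuples of elements of the domain, nothing needs to be known about the
  -- values of the permutation outside of it.
  have hsame : ∀ n r, IsRelationOn E N.dom n r → (n, r) ∈ R →
      extension E₁ n (i r) = extension E₂ n (i r) := by
    intro n r hr hrR
    have hdom : ∀ x ∈ extension E₁ n (i r), ∀ j, E₁ (x j) (i N.dom) := fun x hx j =>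
      ((UniformlyDefinable.extension_subset (0 : Fin 2) 1 j).iff_of_isElementaryExtension hi
        ![r, N.dom]).2 (fun y hy => hr.mem_of_mem_extension hM.pairing hy j) x hx
    ext x
    rw [hext]
    constructor
    · intro hx
      exact (hπR n r hrR x (hdom x hx)).2 hx
    · intro hx
      exact (hπR n r hrR x fun j => (hπd _).1 (hdom _ hx j)).1 hx
  refine ⟨K, E₁, E₂, i, hi, ?_, ⟨?_, ?_, ?_⟩, ?_⟩
  · have h := (isElementaryExtension_of_equiv (E := E₁) (E' := E₂) π.symm
      fun x y => by simp [E₂]).comp hi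
    have : π.symm ∘ i = i := funext fun m => π.symm_apply_eq.2 (hπi m).symm
    rwa [this] at h
  · ext x
    change E₁ x (i N.dom) ↔ E₁ (π x) (π (i N.dom))
    rw [hπi, hπd]
  · exact fun {n} f => hsame _ _ (hN.isFunctionOn f).1 (.inl ⟨⟨n, f⟩, rfl⟩)
  · exact fun {n} r => hsame _ _ (hN.isRelationOn r) (.inr ⟨⟨n, r⟩, rfl⟩)
  · intro h
    rw [h, hext] at ha
    exact hπa ha
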